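/- **Setting.** Let $\mathcal X\subseteq\mathbb R^{n}$ be a Borel set, $\mathcal U\subset\mathbb R^{m}$ a finite nonempty input set, $\mathcal Y$ a finite output set, $f:\mathcal X\times\mathcal U\to\mathbb R^n$ with $f(\cdot,u)$ measurable for each $u$, and $h:\mathcal X\to\mathcal Y$ measurable. The transition system $S_\Sigma$ has state set $\mathcal X\cup\{x_{\rm abs}\}$, all states initial, inputs $\mathcal U$, outputs $\mathcal Y\cup\{y_{\rm abs}\}$, output map $\mathcal H=h$ on $\mathcal X$ and $\mathcal H(x_{\rm abs})=y_{\rm abs}$; the unique $u$-successor of $x\in\mathcal X$ is $f(x,u)$ if $f(x,u)\in\mathcal X$ and $x_{\rm abs}$ otherwise, and $x_{\rm abs}$ is absorbing. For a transition system $S=(X,X_0,\mathcal U,\delta,Y,\mathcal H)$ an $H$-long internal behavior is $\xi=x_0u_0x_1\dots u_{H-1}x_H$ with $x_0\in X_0$ and $(x_i,u_i,x_{i+1})\in\delta$; its external behavior is $\mathcal H(\xi)=\mathcal H(x_0)u_0\dots u_{H-1}\mathcal H(x_H)$. $\mathcal I_H(S)$ is the set of internal behaviors and $\mathcal I_H(S,x,\mathbf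 u)$ the set of those starting in $x$ under $\mathbf u\in\mathcal U^H$. For a sequence $\gamma$, $\gamma[k-\ell,k]$ is the subsequence with $\ell+1$ outputs and $\ell$ inputs ending at time $k$, entries at negative times being a symbol $\diamond$. Fix integers $0\le\ell<H$, $N\ge0$, and $\beta\in(0,1)$. Let $\mu_x$ be a probability measure on the states of $S_\Sigma$, $\mu_{\mathbf u}$ the uniform distribution on $\mathcal U^H$ and $\mu_p=\mu_x\times\mu_{\mathbf u}$. From $N$ i.i.d. samples $(x^i,\mathbf u^i)\sim\mu_p$ let $D$ be the set of the external behaviors of $S_\Sigma$ from $x^i$ under $\mathbf u^i$, and $\hat\Pi_j=\{\gamma[k-j,k]:\gamma\in D,\ 0\le k\le H\}$. The data-driven abstraction $\hat S_\ell$ has state set $\hat\Pi_\ell$, initial states those $\zeta\in\hat\Pi_\ell$ with $\zeta=\mathcal H(\xi)[-\ell,0]$ for some $\xi\in\mathcal I_H(S_\Sigma)$, output map $\zeta\mapsto$ last output of $\zeta$, and transitions $(\zeta,u,\zeta')$ such that $\zeta$ without its first output and input equals $\zeta'$ without its last input and output (no condition if $\ell=0$), the last input of $\zeta'$ is $u$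 (no condition if $\ell=0$), and $\zeta$ followed by $u$ and the last output of $\zeta'$ belongs to $\hat\Pi_{\ell+1}$. The relation $\hat{\mathcal R}$ consists of the pairs $(x,\zeta)$, $\zeta\in\hat\Pi_\ell$, for which there are $\xi\in\mathcal I_H(S_\Sigma)$ and $0\le j\le H$ with $\xi(j)=x$ and $\zeta=\mathcal H(\xi)[j-\ell,j]$. Put $\hat{\mathcal Z}=\hat{\mathcal R}^{-1}$. The violation set $\mathcal Q$ is the set of initial states $x$ of $S_\Sigma$ for which there is $\mathbf u\in\mathcal U^H$ such that, with $I^a=\mathcal I_H(S_\Sigma,x,\mathbf u)$ and $I^b$ the union of $\mathcal I_H(\hat S_\ell,\zeta,\mathbf u)$ over the initial states $\zeta$ of $\hat S_\ell$ with $(\zeta,x)\in\hat{\mathcal Z}$: $I^b\neq\emptyset$, and either $I^a=\emptyset$ or some $\xi_a\in I^a$ admits no $\xi_b\in I^b$ with the same external behavior and $(\xi_b(k),\xi_a(k))\in\hat{\mathcal Z}$ for all $0\le k\le H$. One says that $\hat{\mathcal Z}$ is a *probabilistic alternating simulation relation* (PASR) from $\hat S_\ell$ to $S_\Sigma$ until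 horizon $H$ with probability not less than $1-\bar\epsilon$ if $\mu_x(\mathcal Q)\le\bar\epsilon$. Let $s^*$ be the smallest cardinality of a subset of $D$ that has the same set $\hat\Pi_{\ell+1}$ of $(\ell+1)$-sequences as $D$. Let $\epsilon(N,\beta,N)=1$ and, for $k<N$, $\epsilon(k,\beta,N)=1-t$ where $t$ is the unique solution in $(0,1)$ of $$\binom Nk t^{N-k}=\frac\beta N\sum_{i=k}^{N-1}\binom ik t^{i-k}.$$ **Statement.** With $\bar\epsilon=\min\bigl(1,\epsilon(s^*,\beta,N)\,|\mathcal U^H|\bigr)$, the event (over the $N$ samples) that $\hat{\mathcal Z}$ is a PASR from $\hat S_\ell$ to $S_\Sigma$ until horizon $H$ with probability not less than $1-\bar\epsilon$ is measurable and has $\mu_p^N$-probability at least $1-\beta$: $$\mu_p^N\bigl(\mu_x(\mathcal Q)\le\bar\epsilon\bigr)\ge 1-\beta .$$ -/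

import Mathlib

open MeasureTheory ProbabilityTheory

namespace Slca

/-- An alternating sequence `m₀ a₀ m₁ … aₙ₋₁ mₙ`. -/
@[ext]
structure IOSeq (M A : Type*) (n : ℕ) where
  st : Fin (n + 1) → M
  inp : Fin n → A

namespace IOSeq

variable {M M' A : Type*} {n : ℕ}

/-- Apply a map to the elements `mᵢ`, keeping the `aᵢ`. -/
def map (g : M → M') (s : IOSeq M A n) : IOSeq M' A n where
  st := fun i => g (s.st i)
  inp := s.inp

/-- The element `mᵢ` for an integer index `i`; outside `[0, n]` it is the symbol `⋄`,
which is represented by `none`. -/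
def stAt (s : IOSeq M A n) (i : ℤ) : Option M :=
  if h : 0 ≤ i ∧ i ≤ n then some (s.st ⟨i.toNat, by omega⟩) else none

/-- The element `aᵢ` for an integer index `i`, with `⋄ = none` outside `[0, n - 1]`. -/
def inpAt (s : IOSeq M A n) (i : ℤ) : Option A :=
  if h : 0 ≤ i ∧ i < n then some (s.inp ⟨i.toNat, by omega⟩) else none

/-- The `l`-long subsequence `s[k - l, k]`, padded with `⋄` at negative times. -/
def window (s : IOSeq M A n) (l k : ℕ) : IOSeq (Option M) (Option A) l where
  st := fun j => s.stAt ((k : ℤ) - l + (j : ℕ))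
  inp := fun j => s.inpAt ((k : ℤ) - l + (j : ℕ))

/-- Append the pair `a m` at the end of a sequence. -/
def snoc (s : IOSeq M A n) (a : A) (m : M) : IOSeq M A (n + 1) where
  st := Fin.snoc (α := fun _ => M) s.st m
  inp := Fin.snoc (α := fun _ => A) s.inp a

theorem window_last_isSome (s : IOSeq M A n) (l k : ℕ) (hk : k ≤ n) :
    ((s.window l k).st (Fin.last l)).isSome := by
  have h : 0 ≤ (k : ℤ) - l + ((Fin.last l : Fin (l + 1)) : ℕ) ∧
      (k : ℤ) - l + ((Fin.last l : Fin (l + 1)) : ℕ) ≤ n := by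
    simp only [Fin.val_last]; omega
  simp only [window, stAt]
  rw [dif_pos h]
  rfl

end IOSeq

/-! ### Transition systems and their behaviors -/

/-- A transition system with inputs in `U` and outputs in `Y`. -/
structure TransitionSystem (U : Type*) (Y : Type*) where
  X : Type*
  X0 : Set X
  δ : Set (X × U × X)
  out : X → Y

namespace TransitionSystem

variable {U Y : Type*}

/-- The `H`-long internal behaviors. -/
def internal (S : TransitionSystem U Y) (H : ℕ) : Set (IOSeq S.X U H) :=
  {ξ | ξ.st 0 ∈ S.X0 ∧ ∀ i : Fin H, (ξ.st i.castSucc, ξ.inp i, ξ.st i.succ) ∈ S.δ}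

/-- The `H`-long external behaviors. -/
def external (S : TransitionSystem U Y) (H : ℕ) : Set (IOSeq Y U H) :=
  {γ | ∃ ξ ∈ S.internal H, γ = ξ.map S.out}

/-- The internal behaviors starting in `x` under the input sequence `u`. -/
def internalFrom (S : TransitionSystem U Y) (H : ℕ) (x : S.X) (u : Fin H → U) :
    Set (IOSeq S.X U H) :=
  {ξ | ξ ∈ S.internal H ∧ ξ.st 0 = x ∧ ξ.inp = u}

/-- The external behaviors starting in `x` under the input sequence `u`. -/
def externalFrom (S : TransitionSystem U Y) (H : ℕ) (x : S.X) (u : Fin H → U) :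
    Set (IOSeq Y U H) :=
  {γ | ∃ ξ ∈ S.internalFrom H x u, γ = ξ.map S.out}

end TransitionSystem

/-- The behaviors of `Sb` under `u` from all initial states of `Sb` related to `x` by `R`. -/
def relatedFrom {U Y : Type*} (Sa Sb : TransitionSystem U Y) (R : SetRel Sa.X Sb.X)
    (H : ℕ) (x : Sa.X) (u : Fin H → U) : Set (IOSeq Sb.X U H) :=
  ⋃ xb ∈ {xb | (x, xb) ∈ R} ∩ Sb.X0, Sb.internalFrom H xb u

/-- The violation set of a relation `Z ⊆ X_b × X_a` as alternating simulation relation from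
`Sb` to `Sa` until horizon `H`. -/
def altViolation {U Y : Type*} (Sb Sa : TransitionSystem U Y) (Z : SetRel Sb.X Sa.X)
    (H : ℕ) : Set Sa.X :=
  {x | x ∈ Sa.X0 ∧ ∃ u : Fin H → U,
    (relatedFrom Sa Sb Z.inv H x u).Nonempty ∧
    (Sa.internalFrom H x u = ∅ ∨
      ∃ ξa ∈ Sa.internalFrom H x u,
        ¬ ∃ ξb ∈ relatedFrom Sa Sb Z.inv H x u,
          ξa.map Sa.out = ξb.map Sb.out ∧ ∀ k, (ξb.st k, ξa.st k) ∈ Z)}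

/-- `Z` is a probabilistic alternating simulation relation from `Sb` to `Sa` until horizon `H`
with probability not less than `1 - ε`, the initial state of `Sa` being `μ`-distributed. -/
def IsPASR {U Y : Type*} (Sb Sa : TransitionSystem U Y) [MeasurableSpace Sa.X]
    (μ : Measure Sa.X) (Z : SetRel Sb.X Sa.X) (H : ℕ) (ε : ℝ) : Prop :=
  μ (altViolation Sb Sa Z H) ≤ ENNReal.ofReal ε

/-! ### The concrete system -/

/-- A set with one additional (absorbing) element. -/
inductive WithAbs (α : Type*) where
  | pt : α → WithAbs α
  | abs : WithAbs α

/-- The σ-algebra of the disjoint union of `α` and the point `abs`. -/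
instance {α : Type*} [MeasurableSpace α] : MeasurableSpace (WithAbs α) :=
  MeasurableSpace.map WithAbs.pt inferInstance

/-- A control system `x⁺ = f(x, u)`, `y = h(x)` with state set `X ⊆ ℝⁿ` and finite input
set `U ⊆ ℝᵐ`; the values of `f` may leave `X`. -/
structure ControlSystem (n m : ℕ) (Y : Type*) where
  X : Set (EuclideanSpace ℝ (Fin n))
  U : Finset (EuclideanSpace ℝ (Fin m))
  f : X → U → EuclideanSpace ℝ (Fin n)
  h : X → Y

namespace ControlSystem

variable {n m : ℕ} {Y : Type*} (Sg : ControlSystem n m Y)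

open Classical in
/-- The transition map, with the absorbing state as successor when `f(x, u) ∉ X`. -/
noncomputable def step : WithAbs Sg.X → Sg.U → WithAbs Sg.X
  | .pt x, u => if hx : Sg.f x u ∈ Sg.X then .pt ⟨Sg.f x u, hx⟩ else .abs
  | .abs, _ => .abs

/-- The output map; the absorbing state has its own output label. -/
def output : WithAbs Sg.X → WithAbs Y
  | .pt x => .pt (Sg.h x)
  | .abs => .abs

/-- The transition system of the control system; every state is initial. -/
noncomputable def toTS : TransitionSystem Sg.U (WithAbs Y) where
  X := WithAbs Sg.X
  X0 := Set.univ
  δ := {p | p.2.2 = Sg.step p.1 p.2.1}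
  out := Sg.output

noncomputable instance : MeasurableSpace Sg.toTS.X :=
  inferInstanceAs (MeasurableSpace (WithAbs Sg.X))

end ControlSystem

/-! ### `l`-sequences and the data-driven abstraction -/

section Abstraction

variable {U Y : Type*}

/-- The set of all `l`-sequences of the behaviors in `G`. -/
def tiles {H : ℕ} (G : Set (IOSeq Y U H)) (l : ℕ) : Set (IOSeq (Option Y) (Option U) l) :=
  {ζ | ∃ γ ∈ G, ∃ k ≤ H, ζ = γ.window l k}

theorem tiles_last_isSome {H : ℕ} {G : Set (IOSeq Y U H)} {l : ℕ}
    {ζ : IOSeq (Option Y) (Option U) l} (hζ : ζ ∈ tiles G l) :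
    (ζ.st (Fin.last l)).isSome := by
  obtain ⟨γ, -, k, hk, rfl⟩ := hζ
  exact γ.window_last_isSome l k hk

/-- The corresponding external strings of length `l` of a state `x`. -/
def ces (S : TransitionSystem U Y) (H l : ℕ) (x : S.X) :
    Set (IOSeq (Option Y) (Option U) l) :=
  {ζ | ζ ∈ tiles (S.external H) l ∧
    ∃ ξ ∈ S.internal H, ∃ j : Fin (H + 1), ζ = (ξ.map S.out).window l j ∧ ξ.st j = x}

/-- The data-driven abstraction built from a set `D` of `H`-long external behaviors of `S`.
In a transition from `ζ` to `ζ'` under `u`, the last `l` outputs of `ζ` and the inputs between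
them are the first ones of `ζ'`, the last input of `ζ'` is `u`, and `ζ` followed by `u` and the
last output of `ζ'` is an `(l + 1)`-sequence of the data. -/
def dataAbstraction (S : TransitionSystem U Y) (H l : ℕ) (D : Set (IOSeq Y U H)) :
    TransitionSystem U Y where
  X := tiles D l
  X0 := {ζ | ∃ ξ ∈ S.internal H, (ξ.map S.out).window l 0 = ζ.1}
  δ := {p |
    (∀ i : Fin l, p.1.1.st i.succ = p.2.2.1.st i.castSucc) ∧
    (∀ i j : Fin l, (i : ℕ) = j + 1 → p.1.1.inp i = p.2.2.1.inp j) ∧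
    (∀ i : Fin l, (i : ℕ) + 1 = l → p.2.2.1.inp i = some p.2.1) ∧
    p.1.1.snoc (some p.2.1) (p.2.2.1.st (Fin.last l)) ∈ tiles D (l + 1)}
  out := fun ζ => (ζ.1.st (Fin.last l)).get (tiles_last_isSome ζ.2)

/-- The relation between states `x` of `S` and states `ζ` of the data-driven abstraction:
`ζ` is a corresponding external string of `x`. -/
def dataRel (S : TransitionSystem U Y) (H l : ℕ) (D : Set (IOSeq Y U H)) :
    SetRel S.X (dataAbstraction S H l D).X :=
  {p | p.2.1 ∈ ces S H l p.1}

/-- The set of external behaviors sampled from `N` pairs of an initial state and an input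
sequence. -/
def dataSet (S : TransitionSystem U Y) (H : ℕ) {N : ℕ} (ω : Fin N → S.X × (Fin H → U)) :
    Set (IOSeq Y U H) :=
  ⋃ i, S.externalFrom H (ω i).1 (ω i).2

/-- The complexity: the least cardinality of a subset of the data with the same
`(l + 1)`-sequences as the data. -/
noncomputable def complexity {H : ℕ} (l : ℕ) (D : Set (IOSeq Y U H)) : ℕ :=
  sInf {c | ∃ D' ⊆ D, D'.Finite ∧ D'.ncard = c ∧ tiles D' (l + 1) = tiles D (l + 1)}

end Abstraction

/-! ### The scenario bound -/

/-- `t ∈ (0, 1)` solves `C(N,k) t^(N-k) = (β/N) ∑_{i=k}^{N-1} C(i,k) t^(i-k)`. -/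
def IsScenarioRoot (N k : ℕ) (β t : ℝ) : Prop :=
  0 < t ∧ t < 1 ∧
    (N.choose k : ℝ) * t ^ (N - k) =
      β / N * ∑ i ∈ Finset.Ico k N, (i.choose k : ℝ) * t ^ (i - k)

/-- The scenario bound `ε(k, β, N)`: it is `1` for `k = N`, and `1 - t` with `t` the unique root
for `k < N`. -/
noncomputable def scenarioBound (k : ℕ) (β : ℝ) (N : ℕ) : ℝ :=
  if k < N then 1 - sInf {t | IsScenarioRoot N k β t} else 1

theorem existsUnique_scenarioRoot {N k : ℕ} {β : ℝ} (hk : k < N) (h0 : 0 < β) (h1 : β < 1) :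
    ∃! t, IsScenarioRoot N k β t := by
  have hN : (0 : ℝ) < N := by exact_mod_cast (by omega : 0 < N)
  have hC : (0 : ℝ) < N.choose k := by exact_mod_cast Nat.choose_pos hk.le
  have hb : 0 < β / N := div_pos h0 hN
  set F : ℝ → ℝ := fun t => ∑ i ∈ Finset.Ico k N, (i.choose k : ℝ) * t ^ (i - k) with hF
  have hex : ∃ t ∈ Set.Ioo (0 : ℝ) 1, (N.choose k : ℝ) * t ^ (N - k) - β / N * F t = 0 := by
    have hc : ContinuousOn (fun t : ℝ => (N.choose k : ℝ) * t ^ (N - k) - β / N * F t)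
        (Set.Icc 0 1) := by
      apply Continuous.continuousOn
      simp only [hF]
      fun_prop
    have hz : F 0 = 1 := by
      simp only [hF]
      rw [Finset.sum_eq_single k]
      · simp
      · intro i hi hik
        have : i - k ≠ 0 := by have := (Finset.mem_Ico.1 hi).1; omega
        simp [this]
      · intro h; exact absurd (Finset.mem_Ico.2 ⟨le_rfl, hk⟩) h
    have ho : F 1 ≤ N * N.choose k := by
      simp only [hF, one_pow, mul_one]
      calc ∑ i ∈ Finset.Ico k N, (i.choose k : ℝ)
          ≤ ∑ i ∈ Finset.Ico k N, (N.choose k : ℝ) := by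
            apply Finset.sum_le_sum
            intro i hi
            exact_mod_cast Nat.choose_le_choose k (Finset.mem_Ico.1 hi).2.le
        _ ≤ N * N.choose k := by
            rw [Finset.sum_const, nsmul_eq_mul, Nat.card_Ico]
            gcongr
            omega
    have := intermediate_value_Ioo (zero_le_one' ℝ) hc
    refine this ⟨?_, ?_⟩
    · have : N - k ≠ 0 := by omega
      simp only [hz, ne_eq, this, not_false_eq_true, zero_pow, mul_zero]
      linarith
    · have : β / N * F 1 ≤ β * N.choose k := by
        calc β / N * F 1 ≤ β / N * (N * N.choose k) := by gcongr
          _ = β * N.choose k := by field_simp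
      simp only [one_pow, mul_one]
      nlinarith
  have key : ∀ s t, IsScenarioRoot N k β s → IsScenarioRoot N k β t → ¬ s < t := by
    rintro s t ⟨hs0, -, hs⟩ ⟨ht0, -, ht⟩ hst
    have hr : 1 < t / s := (one_lt_div hs0).2 hst
    have hlt : F t < (t / s) ^ (N - k) * F s := by
      simp only [hF, Finset.mul_sum]
      apply Finset.sum_lt_sum_of_nonempty ⟨k, Finset.mem_Ico.2 ⟨le_rfl, hk⟩⟩
      intro i hi
      obtain ⟨hi1, hi2⟩ := Finset.mem_Ico.1 hi
      have hci : (0 : ℝ) < i.choose k := by exact_mod_cast Nat.choose_pos hi1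
      have e : t ^ (i - k) = (t / s) ^ (i - k) * s ^ (i - k) := by
        rw [← mul_pow, div_mul_cancel₀ _ hs0.ne']
      have hp : (t / s) ^ (i - k) < (t / s) ^ (N - k) := pow_lt_pow_right₀ hr (by omega)
      calc (i.choose k : ℝ) * t ^ (i - k)
          = (t / s) ^ (i - k) * (i.choose k * s ^ (i - k)) := by rw [e]; ring
        _ < (t / s) ^ (N - k) * (i.choose k * s ^ (i - k)) := by gcongr
    have e : t ^ (N - k) = (t / s) ^ (N - k) * s ^ (N - k) := by
      rw [← mul_pow, div_mul_cancel₀ _ hs0.ne']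
    have h2 : β / N * F t < β / N * ((t / s) ^ (N - k) * F s) := by gcongr
    have h3 : (N.choose k : ℝ) * t ^ (N - k) = β / N * ((t / s) ^ (N - k) * F s) := by
      rw [e, mul_left_comm, hs]; ring
    change (N.choose k : ℝ) * t ^ (N - k) = β / N * F t at ht
    linarith
  obtain ⟨t, ⟨ht0, ht1⟩, ht⟩ := hex
  refine ⟨t, ⟨ht0, ht1, sub_eq_zero.1 ht⟩, fun s hs => ?_⟩
  have htr : IsScenarioRoot N k β t := ⟨ht0, ht1, sub_eq_zero.1 ht⟩
  exact le_antisymm (not_lt.1 (key t s htr hs)) (not_lt.1 (key s t hs htr))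

end Slca

open Slca

/-! An external behavior is a point `e` of a finite set `E`, with law `p` the image of `μx.prod μu`
under `trace`; attach to `e` its set of `(l + 1)`-sequences. A subfamily of the data with the same
sequences as the whole is a compression. Ties are broken by an injective `key` that refines
cardinality, so the selected index set `I` is unique and `I.card` is the complexity.

Let `r` be the `p`-probability that a new behavior is covered by `I`. If `I` violates the scenario
bound, then `r` is below the root `t`, and the root equation gives `1 ≤ (β/N) ∑ₘ C(N,m)⁻¹ ∑_J r⁻¹ ^
(N-m)`, with `J ⊇ I` of size `m`. If `I` is selected from all samples, it is selected from `J`, and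
the other `N - m` samples are covered by `I`. Those are independent of the samples in `J`, so they
contribute a factor `r ^ (N-m)`, which cancels the weight (`lintegral_isSelected_union_le`). What
remains is the probability that `I` is selected from `J`. Summed over `I` this is at most `1`, and
the `N` values of `m` give `β`.

A trajectory whose `(l + 1)`-sequences all occur in the data is reproduced by its sliding windows
(`exists_related_of_tiles_subset`). A violating state therefore has some input sequence with an
uncovered trace; the union bound over uniform inputs costs the factor `|U^H|`. -/

namespace Slca

open scoped ENNReal

/-! ### The scenario bound for set-covering compressions -/

/-- The union of the sets attached to the samples with index in `I`. -/
def cover {ι E α : Type*} (τ : E → Set α) (ω : ι → E) (I : Finset ι) : Set α :=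
  ⋃ i ∈ I, τ (ω i)

/-- `I` is the sub-family of `J` of least `key` among those with the same cover as `J`. -/
def IsSelected {ι E α : Type*} (key : Finset ι → ℕ) (τ : E → Set α) (ω : ι → E)
    (J I : Finset ι) : Prop :=
  I ⊆ J ∧ cover τ ω I = cover τ ω J ∧
    ∀ K ⊆ J, cover τ ω K = cover τ ω J → key I ≤ key K

section Selection

variable {ι E α : Type*} {key : Finset ι → ℕ} {τ : E → Set α} {ω : ι → E}

theorem cover_mono {I J : Finset ι} (h : I ⊆ J) : cover τ ω I ⊆ cover τ ω J :=
  Set.biUnion_subset_biUnion_left h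

theorem subset_cover {i : ι} {J : Finset ι} (h : i ∈ J) : τ (ω i) ⊆ cover τ ω J :=
  Set.subset_biUnion_of_mem (u := fun i => τ (ω i)) h

theorem cover_update [DecidableEq ι] {j : ι} {I : Finset ι} (hj : j ∉ I) (e : E) :
    cover τ (Function.update ω j e) I = cover τ ω I := by
  unfold cover
  refine Set.iUnion₂_congr fun i hi => ?_
  rw [Function.update_of_ne]
  rintro rfl
  exact hj hi

theorem IsSelected.unique (hkey : Function.Injective key) {J I I' : Finset ι}
    (h : IsSelected key τ ω J I) (h' : IsSelected key τ ω J I') : I = I' :=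
  hkey (le_antisymm (h.2.2 _ h'.1 h'.2.1) (h'.2.2 _ h.1 h.2.1))

theorem exists_isSelected (key : Finset ι → ℕ) (τ : E → Set α) (ω : ι → E) (J : Finset ι) :
    ∃ I, IsSelected key τ ω J I := by
  obtain ⟨I, ⟨h1, h2⟩, h3⟩ := exists_minimalFor_of_wellFoundedLT
    (fun I => I ⊆ J ∧ cover τ ω I = cover τ ω J) key ⟨J, subset_rfl, rfl⟩
  exact ⟨I, h1, h2, fun K hK hK' => (le_total (key I) (key K)).elim id fun h => h3 ⟨hK, hK'⟩ h⟩

/-- The selection has the preference property: a selected family stays selected when unselected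
samples are removed. -/
theorem IsSelected.of_subset {I J K : Finset ι} (h : IsSelected key τ ω K I) (hIJ : I ⊆ J)
    (hJK : J ⊆ K) : IsSelected key τ ω J I := by
  -- The cover of `J` lies between those of `I` and `K`, which agree.
  have hJ : cover τ ω J = cover τ ω K :=
    (cover_mono hJK).antisymm (h.2.1 ▸ cover_mono hIJ)
  exact ⟨hIJ, h.2.1.trans hJ.symm, fun L hL hL' => h.2.2 L (hL.trans hJK) (hL'.trans hJ)⟩

theorem isSelected_update [DecidableEq ι] {j : ι} {I J : Finset ι} (hj : j ∉ J) (e : E) :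
    IsSelected key τ (Function.update ω j e) J I ↔ IsSelected key τ ω J I := by
  have hc : ∀ K ⊆ J, cover τ (Function.update ω j e) K = cover τ ω K :=
    fun K hK => cover_update (fun h => hj (hK h)) e
  unfold IsSelected
  refine and_congr_right fun hI => ?_
  rw [hc I hI, hc J subset_rfl]
  refine and_congr_right fun _ => forall₂_congr fun K hK => ?_
  rw [hc K hK]

/-- An injective ranking of the finite subsets that refines the ranking by cardinality. -/
theorem exists_injective_key (ι : Type*) [Fintype ι] :
    ∃ key : Finset ι → ℕ, Function.Injective key ∧ ∀ I J, key I ≤ key J → I.card ≤ J.card := by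
  classical
  let e := Fintype.equivFin (Finset ι)
  -- Since `e I` is below the number of subsets, the code orders lexicographically: cardinality
  -- first, then `e`.
  have hlt : ∀ I J : Finset ι, I.card < J.card →
      I.card * Fintype.card (Finset ι) + e I < J.card * Fintype.card (Finset ι) + e J := by
    intro I J h
    have := (e I).2
    nlinarith
  refine ⟨fun I => I.card * Fintype.card (Finset ι) + e I, fun I J h => ?_, fun I J h => ?_⟩
  · have hc : I.card = J.card := by
      rcases lt_trichotomy I.card J.card with h' | h' | h'
      · exact absurd h (hlt _ _ h').ne
      · exact h'
      · exact absurd h (hlt _ _ h').ne'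
    simp only [hc, add_right_inj] at h
    exact e.injective (Fin.ext h)
  · by_contra! h'
    exact absurd (hlt _ _ h') (not_lt.2 h)

end Selection

/-- Integrating out one coordinate does not change the integral over a product of copies of a
probability measure. -/
theorem lintegral_pi_resample {ι E : Type*} [Fintype ι] [DecidableEq ι] [MeasurableSpace E]
    (p : Measure E) [IsProbabilityMeasure p] (f : (ι → E) → ℝ≥0∞)
    (hf : Measurable f) (j : ι) :
    ∫⁻ ω, f ω ∂Measure.pi (fun _ : ι => p) =
      ∫⁻ ω, ∫⁻ e, f (Function.update ω j e) ∂p ∂Measure.pi (fun _ : ι => p) := by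
  -- Passing to marginals needs a base point; without one both integrals vanish.
  rcases isEmpty_or_nonempty (ι → E) with h | ⟨⟨x⟩⟩
  · simp [Measure.eq_zero_of_isEmpty]
  have hg : Measurable fun ω : ι → E => ∫⁻ e, f (Function.update ω j e) ∂p := by
    have := hf.lmarginal (fun _ : ι => p) (s := {j})
    rwa [lmarginal_singleton] at this
  rw [lintegral_eq_lmarginal_univ x, lintegral_eq_lmarginal_univ x,
    lmarginal_erase' f hf (Finset.mem_univ j), lmarginal_erase' _ hg (Finset.mem_univ j)]
  simp

section Scenario

variable {ι E α : Type*} [Fintype ι] [DecidableEq ι] [Finite E] [MeasurableSpace E]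
  [MeasurableSingletonClass E]

open Classical in
/-- A selected family of `J ∪ K` is selected in `J`, and the samples of `K` do not enlarge its
cover; the latter are independent of the former. -/
theorem lintegral_isSelected_union_le (p : Measure E) [IsProbabilityMeasure p]
    (key : Finset ι → ℕ) (τ : E → Set α) {I J : Finset ι} (hIJ : I ⊆ J) (K : Finset ι) :
    Disjoint J K → ∀ φ : Set α → ℝ≥0∞,
      ∫⁻ ω, (if IsSelected key τ ω (J ∪ K) I then φ (cover τ ω I) else 0)
          ∂Measure.pi (fun _ : ι => p) ≤
        ∫⁻ ω, (if IsSelected key τ ω J I then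
          φ (cover τ ω I) * p {e | τ e ⊆ cover τ ω I} ^ K.card else 0)
          ∂Measure.pi (fun _ : ι => p) := by
  induction K using Finset.induction_on with
  | empty => intro _ φ; simp
  | insert j K hjK ih =>
    intro hd φ
    rw [Finset.disjoint_insert_right] at hd
    have hj : j ∉ J ∪ K := by simp [hd.1, hjK]
    have hjI : j ∉ I := fun h => hd.1 (hIJ h)
    calc ∫⁻ ω, (if IsSelected key τ ω (J ∪ insert j K) I then φ (cover τ ω I) else 0)
          ∂Measure.pi (fun _ : ι => p)
        ≤ ∫⁻ ω, (if IsSelected key τ ω (J ∪ K) I then φ (cover τ ω I) *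
            {e | τ e ⊆ cover τ ω I}.indicator 1 (ω j) else 0)
          ∂Measure.pi (fun _ : ι => p) := by
          -- Removing the unselected sample `j` keeps `I` selected, and `τ (ω j)` lies in the cover
          -- of `I`, which is the full cover.
          refine lintegral_mono fun ω => ?_
          dsimp only
          split_ifs with h1 h2 h2
          · have : ω j ∈ {e | τ e ⊆ cover τ ω I} := by
              change τ (ω j) ⊆ cover τ ω I
              rw [h1.2.1]
              exact subset_cover (by simp)
            simp [Set.indicator_of_mem this]
          · refine absurd (h1.of_subset (hIJ.trans Finset.subset_union_left) ?_) h2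
            exact Finset.union_subset_union_right (Finset.subset_insert _ _)
          · exact zero_le
          · exact le_rfl
      _ = ∫⁻ ω, (if IsSelected key τ ω (J ∪ K) I then φ (cover τ ω I) *
            p {e | τ e ⊆ cover τ ω I} else 0) ∂Measure.pi (fun _ : ι => p) := by
          -- As `j ∉ J ∪ K`, coordinate `j` enters only through the indicator, so integrating it out
          -- yields a probability.
          rw [lintegral_pi_resample p _ (Measurable.of_discrete) j]
          refine lintegral_congr fun ω => ?_
          simp only [isSelected_update hj, cover_update hjI, Function.update_self]
          split_ifs
          · rw [lintegral_const_mul _ Measurable.of_discrete,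
              lintegral_indicator_one (MeasurableSet.of_discrete)]
          · simp
      _ ≤ _ := by
          -- The new factor is absorbed into `φ`; this is why the induction runs over all `φ`.
          refine (ih hd.2 fun C => φ C * p {e | τ e ⊆ C}).trans_eq ?_
          refine lintegral_congr fun ω => ?_
          simp only [Finset.card_insert_of_notMem hjK, pow_succ', mul_assoc]

-- With `K = Jᶜ`, the weight `r⁻¹ ^ (N - m)` cancels the factor `r ^ Jᶜ.card`. If `r = 0`, the
-- product `∞ * 0` is `0`, so the bound by `1` persists.
open Classical in
theorem lintegral_isSelected_univ_le (p : Measure E) [IsProbabilityMeasure p]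
    (key : Finset ι → ℕ) (τ : E → Set α) {I J : Finset ι} (hIJ : I ⊆ J) {m : ℕ}
    (hm : J.card = m) :
    ∫⁻ ω, (if IsSelected key τ ω Finset.univ I then
        (p {e | τ e ⊆ cover τ ω I})⁻¹ ^ (Fintype.card ι - m) else 0)
        ∂Measure.pi (fun _ : ι => p) ≤
      ∫⁻ ω, (if IsSelected key τ ω J I then 1 else 0) ∂Measure.pi (fun _ : ι => p) := by
  have h := lintegral_isSelected_union_le p key τ hIJ Jᶜ disjoint_compl_right
    fun C => (p {e | τ e ⊆ C})⁻¹ ^ (Fintype.card ι - m)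
  rw [Finset.union_compl, Finset.card_compl, hm] at h
  refine h.trans (lintegral_mono fun ω => ?_)
  dsimp only
  split_ifs
  · rw [← mul_pow]
    exact pow_le_one₀ zero_le (ENNReal.inv_mul_le_one _)
  · exact le_rfl

end Scenario

-- Injectivity of `key` makes the events "`I` is selected from `J`" disjoint as `I` varies.
open Classical in
theorem sum_isSelected_le_one {ι E α : Type*} [Fintype ι] [Finite E] [MeasurableSpace E]
    [MeasurableSingletonClass E] {key : Finset ι → ℕ} (hkey : Function.Injective key)
    (p : Measure E) [IsProbabilityMeasure p] (τ : E → Set α) (J : Finset ι) :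
    ∑ I, ∫⁻ ω, (if IsSelected key τ ω J I then 1 else 0) ∂Measure.pi (fun _ : ι => p) ≤ 1 := by
  rw [← lintegral_finsetSum _ fun _ _ => Measurable.of_discrete]
  refine (lintegral_mono (g := fun _ => 1) fun ω => ?_).trans (by simp)
  obtain ⟨I, hI⟩ := exists_isSelected key τ ω J
  dsimp only
  rw [Finset.sum_eq_single I]
  · rw [if_pos hI]
  · intro I' _ hne
    rw [if_neg fun h => hne (h.unique hkey hI)]
  · simp

/-- Below the root, the weighted sum in the scenario equation dominates. -/
theorem IsScenarioRoot.choose_le {N k : ℕ} {β t : ℝ} (ht : IsScenarioRoot N k β t) (hk : k < N)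
    (hβ : 0 < β) {r : ℝ≥0∞} (hr : r ≤ ENNReal.ofReal t) :
    (N.choose k : ℝ≥0∞) ≤ ENNReal.ofReal (β / N) *
      ∑ i ∈ Finset.Ico k N, (i.choose k : ℝ≥0∞) * r⁻¹ ^ (N - i) := by
  obtain ⟨ht0, -, ht⟩ := ht
  -- The root equation divided by `t ^ (N - k)`; in this form the right side is antitone in `t`, and
  -- `r = 0` is allowed in `ℝ≥0∞`.
  have e : (N.choose k : ℝ) = β / N * ∑ i ∈ Finset.Ico k N, (i.choose k : ℝ) * t⁻¹ ^ (N - i) := by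
    have h0 : t ^ (N - k) ≠ 0 := by positivity
    refine mul_right_cancel₀ h0 ?_
    rw [ht, mul_assoc, Finset.sum_mul]
    congr 1
    refine Finset.sum_congr rfl fun i hi => ?_
    obtain ⟨h1, h2⟩ := Finset.mem_Ico.1 hi
    rw [show N - k = (N - i) + (i - k) by omega, pow_add, inv_pow]
    field_simp
  have e' : (N.choose k : ℝ≥0∞) = ENNReal.ofReal (β / N) *
      ∑ i ∈ Finset.Ico k N, (i.choose k : ℝ≥0∞) * (ENNReal.ofReal t)⁻¹ ^ (N - i) := by
    rw [← ENNReal.ofReal_natCast, e, ENNReal.ofReal_mul (by positivity),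
      ENNReal.ofReal_sum_of_nonneg fun i _ => by positivity]
    congr 1
    refine Finset.sum_congr rfl fun i _ => ?_
    rw [ENNReal.ofReal_mul (by positivity), ENNReal.ofReal_natCast,
      ENNReal.ofReal_pow (by positivity), ENNReal.ofReal_inv_of_pos ht0]
  rw [e']
  gcongr

/-- The scenario inequality, with the binomial weights written as a proportion of the
intermediate sets `I ⊆ J` among the sets of size `m`. -/
theorem IsScenarioRoot.one_le_sum {ι : Type*} [Fintype ι] [DecidableEq ι] {I : Finset ι}
    {β t : ℝ} (ht : IsScenarioRoot (Fintype.card ι) I.card β t)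
    (hk : I.card < Fintype.card ι) (hβ : 0 < β) {r : ℝ≥0∞} (hr : r ≤ ENNReal.ofReal t) :
    1 ≤ ENNReal.ofReal (β / Fintype.card ι) * ∑ m ∈ Finset.range (Fintype.card ι),
      ((Fintype.card ι).choose m : ℝ≥0∞)⁻¹ *
        ∑ J ∈ Finset.powersetCard m Finset.univ with I ⊆ J,
          r⁻¹ ^ (Fintype.card ι - m) := by
  set N := Fintype.card ι with hN
  have h := ht.choose_le hk hβ hr
  have h0 : (N.choose I.card : ℝ≥0∞) ≠ 0 := by
    exact_mod_cast (Nat.choose_pos hk.le).ne'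
  have htop : (N.choose I.card : ℝ≥0∞) ≠ ∞ := ENNReal.natCast_ne_top _
  rw [← ENNReal.mul_le_mul_iff_right h0 htop, mul_one]
  refine h.trans ?_
  rw [mul_left_comm]
  gcongr ENNReal.ofReal _ * ?_
  rw [Finset.mul_sum, Finset.range_eq_Ico]
  refine (Finset.sum_le_sum fun m hm => ?_).trans
    (Finset.sum_le_sum_of_subset (Finset.Ico_subset_Ico_left (Nat.zero_le I.card)))
  obtain ⟨h1, h2⟩ := Finset.mem_Ico.1 hm
  have hm0 : (N.choose m : ℝ≥0∞) ≠ 0 := by exact_mod_cast (Nat.choose_pos h2.le).ne'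
  rw [Finset.sum_const, Finset.card_filter_powersetCard_subset _ _ _ (Finset.subset_univ I) h1,
    Finset.card_univ, ← hN, nsmul_eq_mul]
  -- Both sides count pairs of a set of size `m` and a subset of it of size `I.card`.
  have hc : (N.choose m : ℝ≥0∞) * m.choose I.card =
      N.choose I.card * (N - I.card).choose (m - I.card) := by
    exact_mod_cast Nat.choose_mul h1
  rw [mul_left_comm, ← mul_assoc (N.choose I.card : ℝ≥0∞), ← hc, mul_assoc, ← mul_assoc,
    ENNReal.inv_mul_cancel hm0 (ENNReal.natCast_ne_top _), one_mul]

open Classical in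
/-- The scenario theorem for the set-covering compression: with probability at least `1 - β`, the
probability that a new sample enlarges the cover is at most the scenario bound of the size of the
selected subfamily. -/
theorem measure_scenarioBound_lt_le {ι E α : Type*} [Fintype ι] [Finite E]
    [MeasurableSpace E] [MeasurableSingletonClass E] (p : Measure E) [IsProbabilityMeasure p]
    {key : Finset ι → ℕ} (hkey : Function.Injective key) (τ : E → Set α)
    {β : ℝ} (hβ0 : 0 < β) (hβ1 : β < 1) :
    Measure.pi (fun _ : ι => p) {ω | ∃ I, IsSelected key τ ω Finset.univ I ∧
      ENNReal.ofReal (scenarioBound I.card β (Fintype.card ι)) <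
        p {e | ¬ τ e ⊆ cover τ ω Finset.univ}} ≤ ENNReal.ofReal β := by
  set N := Fintype.card ι with hN
  set P := Measure.pi (fun _ : ι => p)
  set r : (ι → E) → Finset ι → ℝ≥0∞ := fun ω I => p {e | τ e ⊆ cover τ ω I} with hr
  set B : Finset ι → Set (ι → E) := fun I => {ω | IsSelected key τ ω Finset.univ I ∧
      ENNReal.ofReal (scenarioBound I.card β N) < p {e | ¬ τ e ⊆ cover τ ω Finset.univ}}
  have hpt : ∀ I ω, (B I).indicator 1 ω ≤ ENNReal.ofReal (β / N) * ∑ m ∈ Finset.range N,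
      (N.choose m : ℝ≥0∞)⁻¹ * ∑ J ∈ Finset.powersetCard m Finset.univ with I ⊆ J,
        (if IsSelected key τ ω Finset.univ I then (r ω I)⁻¹ ^ (N - m) else 0) := by
    intro I ω
    by_cases hω : ω ∈ B I
    · obtain ⟨hs, hb⟩ := id hω
      simp only [Set.indicator_of_mem hω, Pi.one_apply, if_pos hs]
      -- At `I.card = N` the bound is `1`, which no probability exceeds.
      have hk : I.card < N := by
        by_contra hk
        rw [scenarioBound, if_neg hk, ENNReal.ofReal_one] at hb
        exact absurd hb (not_lt.2 prob_le_one)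
      obtain ⟨t, ht, hu⟩ := existsUnique_scenarioRoot hk hβ0 hβ1
      have hset : {t | IsScenarioRoot N I.card β t} = {t} := by
        ext s
        exact ⟨hu s, fun h => by rw [Set.mem_singleton_iff.1 h]; exact ht⟩
      rw [scenarioBound, if_pos hk, hset, csInf_singleton, ← hs.2.1] at hb
      refine ht.one_le_sum hk hβ0 ?_
      have hcompl : {e | ¬ τ e ⊆ cover τ ω I} = {e | τ e ⊆ cover τ ω I}ᶜ := rfl
      rw [hcompl, prob_compl_eq_one_sub MeasurableSet.of_discrete] at hb
      by_contra! hlt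
      refine absurd hb (not_lt.2 ?_)
      rw [ENNReal.ofReal_sub _ ht.1.le, ENNReal.ofReal_one]
      exact tsub_le_tsub_left hlt.le 1
    · simp [Set.indicator_of_notMem hω]
  have hunion : {ω | ∃ I, IsSelected key τ ω Finset.univ I ∧
      ENNReal.ofReal (scenarioBound I.card β N) < p {e | ¬ τ e ⊆ cover τ ω Finset.univ}} =
      ⋃ I, B I := by
    ext ω; simp [B]
  have hI : ∀ I, P (B I) ≤ ENNReal.ofReal (β / N) * ∑ m ∈ Finset.range N,
      (N.choose m : ℝ≥0∞)⁻¹ * ∑ J ∈ Finset.powersetCard m Finset.univ,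
        ∫⁻ ω, (if IsSelected key τ ω J I then 1 else 0) ∂P := by
    intro I
    rw [← lintegral_indicator_one MeasurableSet.of_discrete]
    refine (lintegral_mono (hpt I)).trans ?_
    rw [lintegral_const_mul _ Measurable.of_discrete,
      lintegral_finsetSum _ fun _ _ => Measurable.of_discrete]
    gcongr with m _
    rw [lintegral_const_mul _ Measurable.of_discrete,
      lintegral_finsetSum _ fun _ _ => Measurable.of_discrete]
    gcongr _ * ?_
    -- Dropping the condition `I ⊆ J` frees the range of `J` from `I`, so the sums can be exchanged
    -- later.
    refine (Finset.sum_le_sum fun J hJ => ?_).trans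
      (Finset.sum_le_sum_of_subset (Finset.filter_subset _ _))
    obtain ⟨hJ1, hJ2⟩ := Finset.mem_filter.1 hJ
    exact lintegral_isSelected_univ_le p key τ hJ2 (Finset.mem_powersetCard.1 hJ1).2
  calc P _ = P (⋃ I, B I) := by rw [hunion]
    _ ≤ ∑ I, P (B I) := measure_iUnion_fintype_le _ _
    _ ≤ ∑ I, ENNReal.ofReal (β / N) * ∑ m ∈ Finset.range N,
      (N.choose m : ℝ≥0∞)⁻¹ * ∑ J ∈ Finset.powersetCard m Finset.univ,
        ∫⁻ ω, (if IsSelected key τ ω J I then 1 else 0) ∂P := Finset.sum_le_sum fun I _ => hI I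
    _ = ENNReal.ofReal (β / N) * ∑ m ∈ Finset.range N,
      (N.choose m : ℝ≥0∞)⁻¹ * ∑ J ∈ Finset.powersetCard m Finset.univ,
        ∑ I, ∫⁻ ω, (if IsSelected key τ ω J I then 1 else 0) ∂P := by
        rw [← Finset.mul_sum, Finset.sum_comm]
        congr 1
        refine Finset.sum_congr rfl fun m _ => ?_
        rw [← Finset.mul_sum, Finset.sum_comm]
    _ ≤ ENNReal.ofReal (β / N) * ∑ m ∈ Finset.range N,
      (N.choose m : ℝ≥0∞)⁻¹ * ∑ J ∈ Finset.powersetCard m (Finset.univ : Finset ι), 1 := by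
        gcongr
        exact sum_isSelected_le_one hkey p τ _
    _ ≤ ENNReal.ofReal (β / N) * ∑ m ∈ Finset.range N, 1 := by
        gcongr
        rw [Finset.sum_const, Finset.card_powersetCard, Finset.card_univ, nsmul_one]
        exact ENNReal.inv_mul_le_one _
    _ ≤ ENNReal.ofReal β := by
        rw [Finset.sum_const, Finset.card_range, nsmul_one, ← ENNReal.ofReal_natCast,
          ← ENNReal.ofReal_mul (by positivity)]
        refine ENNReal.ofReal_le_ofReal ?_
        rcases Nat.eq_zero_or_pos N with h | h
        · simp [h, hβ0.le]
        · field_simp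
          rfl

/-! ### Covered trajectories are reproduced by the data-driven abstraction -/

section Tiles

variable {M A : Type*}

theorem IOSeq.window_st_succ {n : ℕ} (s : IOSeq M A n) (l k : ℕ) (i : Fin (l + 1)) :
    (s.window (l + 1) k).st i.succ = (s.window l k).st i := by
  simp only [IOSeq.window, Fin.val_succ]
  congr 1
  push_cast
  ring

theorem IOSeq.window_inp_succ {n : ℕ} (s : IOSeq M A n) (l k : ℕ) (i : Fin l) :
    (s.window (l + 1) k).inp i.succ = (s.window l k).inp i := by
  simp only [IOSeq.window, Fin.val_succ]
  congr 1
  push_cast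
  ring

/-- Dropping the first entries of a window. -/
theorem IOSeq.window_eq_of_window_succ_eq {n n' : ℕ} {s : IOSeq M A n} {s' : IOSeq M A n'}
    {l k k' : ℕ} (h : s.window (l + 1) k = s'.window (l + 1) k') :
    s.window l k = s'.window l k' := by
  ext1
  · funext i
    rw [← s.window_st_succ, ← s'.window_st_succ, h]
  · funext i
    rw [← s.window_inp_succ, ← s'.window_inp_succ, h]

theorem IOSeq.stAt_coe {n : ℕ} (s : IOSeq M A n) (k : Fin (n + 1)) :
    s.stAt (k : ℕ) = some (s.st k) := by
  rw [IOSeq.stAt, dif_pos (by omega)]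
  rfl

theorem IOSeq.inpAt_coe {n : ℕ} (s : IOSeq M A n) (k : Fin n) :
    s.inpAt (k : ℕ) = some (s.inp k) := by
  rw [IOSeq.inpAt, dif_pos (by omega)]
  rfl

theorem IOSeq.window_st_last {n : ℕ} (s : IOSeq M A n) (l : ℕ) (k : Fin (n + 1)) :
    (s.window l k).st (Fin.last l) = some (s.st k) := by
  rw [← s.stAt_coe]
  simp only [IOSeq.window, Fin.val_last]
  congr 1
  ring

/-- A window extended by the next input and output is the next longer window. -/
theorem IOSeq.window_snoc {n : ℕ} (s : IOSeq M A n) (l : ℕ) (k : Fin n) :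
    (s.window l k).snoc (some (s.inp k)) (some (s.st k.succ)) = s.window (l + 1) (k + 1) := by
  ext1
  · funext i
    refine Fin.lastCases ?_ (fun i => ?_) i
    · have := s.window_st_last (l + 1) k.succ
      rw [Fin.val_succ] at this
      rw [this]
      simp [IOSeq.snoc]
    · simp only [IOSeq.snoc, Fin.snoc_castSucc, IOSeq.window, Fin.val_castSucc]
      congr 1
      push_cast
      ring
  · funext i
    refine Fin.lastCases ?_ (fun i => ?_) i
    · simp only [IOSeq.snoc, Fin.snoc_last, IOSeq.window, Fin.val_last]
      rw [← s.inpAt_coe]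
      congr 1
      push_cast
      ring
    · simp only [IOSeq.snoc, Fin.snoc_castSucc, IOSeq.window, Fin.val_castSucc]
      congr 1
      push_cast
      ring

/-- A window of length `l` is the matching longer window without its first entries; padding makes
this hold at early times too. -/
theorem window_mem_tiles_of_subset {H l : ℕ} {D : Set (IOSeq M A H)} {γ : IOSeq M A H}
    (h : tiles {γ} (l + 1) ⊆ tiles D (l + 1)) {k : ℕ} (hk : k ≤ H) :
    γ.window l k ∈ tiles D l := by
  obtain ⟨γ', h1, k', h2, h3⟩ := h ⟨γ, rfl, k, hk, rfl⟩
  exact ⟨γ', h1, k', h2, IOSeq.window_eq_of_window_succ_eq h3⟩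

theorem tiles_eq_biUnion {H : ℕ} (D : Set (IOSeq M A H)) (l : ℕ) :
    tiles D l = ⋃ γ ∈ D, tiles {γ} l := by
  ext ζ
  simp [tiles]

theorem cover_tiles {ι : Type*} {H : ℕ} (w : ι → IOSeq M A H) (l : ℕ) (I : Finset ι) :
    cover (fun e => tiles {e} l) w I = tiles (w '' I) l := by
  rw [tiles_eq_biUnion, Set.biUnion_image]
  rfl

/-- The complexity of the data is the size of a selected index set. -/
theorem IsSelected.card_eq_complexity {ι : Type*} [Fintype ι] {H l : ℕ}
    {w : ι → IOSeq M A H} {key : Finset ι → ℕ} (hkey : ∀ I J, key I ≤ key J → I.card ≤ J.card)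
    {I : Finset ι} (h : IsSelected key (fun e => tiles {e} (l + 1)) w Finset.univ I) :
    complexity l (Set.range w) = I.card := by
  classical
  have huniv : cover (fun e => tiles {e} (l + 1)) w Finset.univ =
      tiles (Set.range w) (l + 1) := by
    rw [cover_tiles, Finset.coe_univ, Set.image_univ]
  have hmem : (w '' I).ncard ∈ {c | ∃ D' ⊆ Set.range w, D'.Finite ∧ D'.ncard = c ∧
      tiles D' (l + 1) = tiles (Set.range w) (l + 1)} :=
    ⟨w '' I, Set.image_subset_range _ _, I.finite_toSet.image _, rfl, by
      rw [← cover_tiles, h.2.1, huniv]⟩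
  refine le_antisymm ?_ ?_
  · refine (Nat.sInf_le hmem).trans ?_
    refine (Set.ncard_image_le I.finite_toSet).trans_eq ?_
    exact Set.ncard_coe_finset I
  -- Choosing one index for each behavior in an optimal `D'` gives a competitor `K` of the same
  -- size, even if samples repeat.
  · obtain ⟨D', h1, h2, h3, h4⟩ := Nat.sInf_mem ⟨_, hmem⟩
    obtain ⟨K, -, hK⟩ := Set.SurjOn.exists_bijOn_subset
      (f := w) (s := Set.univ) (t := D') (by rwa [Set.SurjOn, Set.image_univ])
    have hKf : K.Finite := Set.toFinite K
    have hle := hkey _ _ (h.2.2 hKf.toFinset (Finset.subset_univ _) (by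
      rw [cover_tiles, hKf.coe_toFinset, hK.image_eq, h4, huniv]))
    refine hle.trans_eq ?_
    rw [complexity, ← h3, ← hK.image_eq, hK.injOn.ncard_image,
      Set.ncard_eq_toFinset_card K hKf]

end Tiles

section Abstraction

variable {U Y : Type*}

/-- If all `(l + 1)`-sequences of a behavior occur in the data, then its windows form a related
behavior of the abstraction. -/
theorem exists_related_of_tiles_subset (S : TransitionSystem U Y) {H l : ℕ}
    {D : Set (IOSeq Y U H)} {x : S.X} {u : Fin H → U} {ξ : IOSeq S.X U H}
    (hξ : ξ ∈ S.internalFrom H x u)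
    (hD : tiles {ξ.map S.out} (l + 1) ⊆ tiles D (l + 1)) :
    ∃ ξb ∈ relatedFrom S (dataAbstraction S H l D) (dataRel S H l D).inv.inv H x u,
      ξ.map S.out = ξb.map (dataAbstraction S H l D).out ∧
        ∀ k, (ξb.st k, ξ.st k) ∈ (dataRel S H l D).inv := by
  obtain ⟨hint, rfl, rfl⟩ := hξ
  set γ := ξ.map S.out
  have hmem : ∀ k : Fin (H + 1), γ.window l k ∈ tiles D l :=
    fun k => window_mem_tiles_of_subset hD k.is_le
  have hext : γ ∈ S.external H := ⟨ξ, hint, rfl⟩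
  have hrel : ∀ k : Fin (H + 1),
      (ξ.st k, (⟨γ.window l k, hmem k⟩ : (dataAbstraction S H l D).X)) ∈ dataRel S H l D :=
    fun k => ⟨⟨γ, hext, k, k.is_le, rfl⟩, ξ, hint, k, rfl, rfl⟩
  have hX0 : (⟨γ.window l (0 : Fin (H + 1)), hmem 0⟩ : (dataAbstraction S H l D).X) ∈
      (dataAbstraction S H l D).X0 := ⟨ξ, hint, rfl⟩
  refine ⟨⟨fun k => ⟨γ.window l k, hmem k⟩, ξ.inp⟩, ?_, ?_, hrel⟩
  · refine Set.mem_biUnion (x := ⟨γ.window l (0 : Fin (H + 1)), hmem 0⟩) ⟨hrel 0, hX0⟩ ?_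
    refine ⟨⟨hX0, fun k => ⟨fun i => ?_, fun i j hij => ?_, fun i hi => ?_, ?_⟩⟩, rfl, rfl⟩
    · simp only [IOSeq.window, Fin.val_succ, Fin.val_castSucc]
      congr 1
      push_cast
      ring
    · simp only [IOSeq.window, Fin.val_succ, Fin.val_castSucc, hij]
      congr 1
      push_cast
      ring
    · have : γ.inp k = ξ.inp k := rfl
      dsimp only
      rw [← this, ← γ.inpAt_coe]
      simp only [IOSeq.window, Fin.val_succ]
      congr 1
      push_cast
      omega
    · dsimp only
      rw [γ.window_st_last l k.succ]
      have : ξ.inp k = γ.inp k := rfl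
      rw [this, Fin.val_castSucc, γ.window_snoc l k]
      exact hD ⟨γ, rfl, _, k.2, rfl⟩
  · ext1
    · funext k
      exact (Option.get_of_eq_some _ (γ.window_st_last l k)).symm
    · rfl

end Abstraction

/-! ### Determinism of the control system and its violation set -/

namespace ControlSystem

variable {n m : ℕ} {Y : Type*} (Sg : ControlSystem n m Y) {H : ℕ}

/-- The unique behavior of the control system from a state under an input sequence. -/
noncomputable def trajectory (x : Sg.toTS.X) (u : Fin H → Sg.U) : IOSeq Sg.toTS.X Sg.U H where
  st := Fin.induction x fun k s => Sg.step s (u k)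
  inp := u

theorem internalFrom_toTS (x : Sg.toTS.X) (u : Fin H → Sg.U) :
    Sg.toTS.internalFrom H x u = {Sg.trajectory x u} := by
  ext ξ
  constructor
  · rintro ⟨⟨-, h⟩, rfl, rfl⟩
    ext1
    · funext k
      induction k using Fin.induction with
      | zero => rfl
      | succ k ih =>
        have := h k
        change ξ.st k.succ = Sg.step (ξ.st k.castSucc) (ξ.inp k) at this
        rw [this, ih]
        rfl
    · rfl
  · rintro rfl
    exact ⟨⟨trivial, fun _ => rfl⟩, rfl, rfl⟩

/-- The external behavior from a state under an input sequence. -/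
noncomputable def trace (x : Sg.toTS.X) (u : Fin H → Sg.U) : IOSeq (WithAbs Y) Sg.U H :=
  (Sg.trajectory x u).map Sg.toTS.out

theorem dataSet_toTS {N : ℕ} (ω : Fin N → Sg.toTS.X × (Fin H → Sg.U)) :
    dataSet Sg.toTS H ω = Set.range fun i => Sg.trace (ω i).1 (ω i).2 := by
  ext γ
  simp only [dataSet, TransitionSystem.externalFrom, internalFrom_toTS, Set.mem_iUnion,
    Set.mem_ofPred_eq, Set.mem_singleton_iff, exists_eq_left, Set.mem_range, trace, eq_comm]

theorem altViolation_subset (l : ℕ) (D : Set (IOSeq (WithAbs Y) Sg.U H)) :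
    altViolation (dataAbstraction Sg.toTS H l D) Sg.toTS (dataRel Sg.toTS H l D).inv H ⊆
      ⋃ u : Fin H → Sg.U, {x | ¬ tiles {Sg.trace x u} (l + 1) ⊆ tiles D (l + 1)} := by
  rintro x ⟨-, u, -, h⟩
  refine Set.mem_iUnion.2 ⟨u, fun hD => ?_⟩
  rcases h with h | ⟨ξ, hξ, h⟩
  · rw [internalFrom_toTS] at h
    exact Set.singleton_ne_empty _ h
  · refine h (exists_related_of_tiles_subset Sg.toTS hξ ?_)
    rw [internalFrom_toTS] at hξ
    rw [Set.mem_singleton_iff.1 hξ]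
    exact hD

/-! ### Measurability -/

theorem measurable_step (hX : MeasurableSet Sg.X) (hf : ∀ u, Measurable fun x => Sg.f x u)
    (u : Sg.U) : Measurable fun x : WithAbs Sg.X => Sg.step x u := by
  -- A set in `WithAbs` is measurable as soon as its preimage under `pt` is, so only states in `X`
  -- need checking.
  intro s hs
  change MeasurableSet {x : Sg.X | Sg.step (.pt x) u ∈ s}
  have : {x : Sg.X | Sg.step (.pt x) u ∈ s} =
      (fun x => Sg.f x u) ⁻¹' (Subtype.val '' (WithAbs.pt ⁻¹' s)) ∪
        (fun x => Sg.f x u) ⁻¹' (Sg.Xᶜ ∩ {_y | WithAbs.abs ∈ s}) := by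
    ext x
    by_cases hx : Sg.f x u ∈ Sg.X <;> simp [step, hx]
  rw [this]
  exact (hf u (hX.subtype_image hs)).union (hf u (hX.compl.inter (MeasurableSet.const _)))

theorem measurableSet_output (hh : ∀ y, MeasurableSet (Sg.h ⁻¹' {y})) (y : WithAbs Y) :
    MeasurableSet (Sg.output ⁻¹' {y}) := by
  change MeasurableSet {x : Sg.X | Sg.output (.pt x) = y}
  cases y with
  | pt y =>
    have : {x : Sg.X | Sg.output (.pt x) = .pt y} = Sg.h ⁻¹' {y} := by
      ext x; simp [output]
    exact this ▸ hh y
  | abs => simp [output]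

theorem measurable_trajectory_st (hX : MeasurableSet Sg.X)
    (hf : ∀ u, Measurable fun x => Sg.f x u) (u : Fin H → Sg.U) (k : Fin (H + 1)) :
    Measurable fun x => (Sg.trajectory x u).st k := by
  induction k using Fin.induction with
  | zero => exact measurable_id
  | succ k ih => exact (Sg.measurable_step hX hf (u k)).comp ih

end ControlSystem

instance {α : Type*} [Finite α] : Finite (WithAbs α) :=
  Finite.of_surjective (fun o : Option α => o.elim WithAbs.abs WithAbs.pt) fun
    | .pt a => ⟨some a, rfl⟩
    | .abs => ⟨none, rfl⟩

instance {M A : Type*} [Finite M] [Finite A] {n : ℕ} : Finite (IOSeq M A n) :=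
  Finite.of_surjective
    (fun p : (Fin (n + 1) → M) × (Fin n → A) => (⟨p.1, p.2⟩ : IOSeq M A n))
    fun s => ⟨(s.st, s.inp), rfl⟩

instance {M A : Type*} {n : ℕ} : MeasurableSpace (IOSeq M A n) := ⊤

instance {M A : Type*} {n : ℕ} : DiscreteMeasurableSpace (IOSeq M A n) := ⟨fun _ => trivial⟩

theorem ControlSystem.measurable_trace {n m : ℕ} {Y : Type*} [Finite Y]
    (Sg : ControlSystem n m Y) {H : ℕ} (hX : MeasurableSet Sg.X)
    (hf : ∀ u, Measurable fun x => Sg.f x u) (hh : ∀ y, MeasurableSet (Sg.h ⁻¹' {y})) :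
    Measurable fun z : Sg.toTS.X × (Fin H → Sg.U) => Sg.trace z.1 z.2 := by
  refine measurable_to_countable' fun γ => ?_
  -- A trace records its inputs, so its fibre is a rectangle with a single input sequence.
  have : (fun z : Sg.toTS.X × (Fin H → Sg.U) => Sg.trace z.1 z.2) ⁻¹' {γ} =
      (⋂ k, (fun x => (Sg.trajectory x γ.inp).st k) ⁻¹' (Sg.output ⁻¹' {γ.st k})) ×ˢ
        {γ.inp} := by
    ext ⟨x, u⟩
    simp only [Set.mem_preimage, Set.mem_singleton_iff, Set.mem_prod, Set.mem_iInter]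
    constructor
    · rintro rfl
      exact ⟨fun _ => rfl, rfl⟩
    · rintro ⟨h, rfl⟩
      exact IOSeq.ext (funext h) rfl
  rw [this]
  refine MeasurableSet.prod (MeasurableSet.iInter fun k => ?_) (MeasurableSet.singleton _)
  exact Sg.measurable_trajectory_st hX hf _ k (Sg.measurableSet_output hh _)

/-- The union bound over a finite set with the uniform distribution. -/
theorem measure_iUnion_le_card_mul_prod {α ι : Type*} [MeasurableSpace α] [Fintype ι] [Nonempty ι]
    [MeasurableSpace ι] [MeasurableSingletonClass ι] (μ : Measure α) [IsProbabilityMeasure μ]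
    {B : Set (α × ι)} (hB : MeasurableSet B) :
    μ (⋃ i, {x | (x, i) ∈ B}) ≤ Fintype.card ι * μ.prod (uniformOn Set.univ) B := by
  have hc : (Fintype.card ι : ENNReal) ≠ 0 := by exact_mod_cast Fintype.card_ne_zero
  refine (measure_iUnion_fintype_le _ _).trans_eq ?_
  rw [Measure.prod_apply_symm hB, lintegral_fintype, Finset.mul_sum]
  refine Finset.sum_congr rfl fun i _ => ?_
  rw [uniformOn_univ, Measure.count_singleton, mul_left_comm,
    ENNReal.mul_div_cancel hc (ENNReal.natCast_ne_top _), mul_one]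
  rfl

end Slca

/-! ### Transfer of the scenario bound to the abstraction -/

theorem mainTheorem1 {n m : ℕ} {Y : Type*} [Finite Y] (Sg : ControlSystem n m Y)
    (hX : MeasurableSet Sg.X) (hU : Sg.U.Nonempty)
    (hf : ∀ u, Measurable fun x => Sg.f x u) (hh : ∀ y, MeasurableSet (Sg.h ⁻¹' {y}))
    (H l N : ℕ) (hl : l < H) (β : ℝ) (hβ0 : 0 < β) (hβ1 : β < 1)
    (μx : Measure Sg.toTS.X) [IsProbabilityMeasure μx]
    (μu : Measure (Fin H → Sg.U)) (hμu : μu = uniformOn Set.univ)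
    (good : Set (Fin N → Sg.toTS.X × (Fin H → Sg.U)))
    (hgood : good = {ω |
      IsPASR (dataAbstraction Sg.toTS H l (dataSet Sg.toTS H ω)) Sg.toTS μx
        (dataRel Sg.toTS H l (dataSet Sg.toTS H ω)).inv H
        (min 1 (scenarioBound (complexity l (dataSet Sg.toTS H ω)) β N *
          (Fintype.card (Fin H → Sg.U) : ℝ)))}) :
    MeasurableSet good ∧
      ENNReal.ofReal (1 - β) ≤ Measure.pi (fun _ : Fin N => μx.prod μu) good := by
  have : Nonempty Sg.U := hU.to_subtype
  have : IsProbabilityMeasure μu := by rw [hμu]; infer_instance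
  let tr : Sg.toTS.X × (Fin H → Sg.U) → IOSeq (WithAbs Y) Sg.U H := fun z => Sg.trace z.1 z.2
  have htr : Measurable tr := Sg.measurable_trace hX hf hh
  let Γ : (Fin N → Sg.toTS.X × (Fin H → Sg.U)) → Fin N → IOSeq (WithAbs Y) Sg.U H :=
    fun ω i => tr (ω i)
  have hΓ : Measurable Γ := measurable_pi_lambda _ fun i => htr.comp (measurable_pi_apply i)
  let pasr : Set (IOSeq (WithAbs Y) Sg.U H) → Prop := fun D =>
    IsPASR (dataAbstraction Sg.toTS H l D) Sg.toTS μx (dataRel Sg.toTS H l D).inv H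
      (min 1 (scenarioBound (complexity l D) β N * (Fintype.card (Fin H → Sg.U) : ℝ)))
  let G : Set (Fin N → IOSeq (WithAbs Y) Sg.U H) := {w | pasr (Set.range w)}
  -- The event depends on the samples only through their traces, which take values in a finite
  -- discrete space; this gives measurability.
  have hG : good = Γ ⁻¹' G := by
    rw [hgood]
    ext ω
    exact iff_of_eq (congrArg pasr (Sg.dataSet_toTS ω))
  have hmeas : MeasurableSet good := hG ▸ hΓ MeasurableSet.of_discrete
  refine ⟨hmeas, ?_⟩
  set p := (μx.prod μu).map tr with hp
  have : IsProbabilityMeasure p := Measure.isProbabilityMeasure_map htr.aemeasurable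
  obtain ⟨key, hkey, hcard⟩ := exists_injective_key (Fin N)
  have hbad := measure_scenarioBound_lt_le p hkey
    (fun e : IOSeq (WithAbs Y) Sg.U H => tiles {e} (l + 1)) hβ0 hβ1
  have hsub : Gᶜ ⊆ {w | ∃ I,
      IsSelected key (fun e : IOSeq (WithAbs Y) Sg.U H => tiles {e} (l + 1)) w Finset.univ I ∧
      ENNReal.ofReal (scenarioBound I.card β (Fintype.card (Fin N))) <
        p {e | ¬ tiles {e} (l + 1) ⊆
          cover (fun e => tiles {e} (l + 1)) w Finset.univ}} := by
    intro w hw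
    obtain ⟨I, hI⟩ := exists_isSelected key
      (fun e : IOSeq (WithAbs Y) Sg.U H => tiles {e} (l + 1)) w Finset.univ
    refine ⟨I, hI, ?_⟩
    by_contra! hle
    refine hw ?_
    change μx _ ≤ _
    rw [hI.card_eq_complexity hcard]
    rw [cover_tiles, Finset.coe_univ, Set.image_univ, Fintype.card_fin, hp,
      Measure.map_apply htr MeasurableSet.of_discrete] at hle
    -- A bound of `1` is trivial; otherwise the union bound over inputs applies.
    rcases min_choice (1 : ℝ) (scenarioBound I.card β N * (Fintype.card (Fin H → Sg.U) : ℝ))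
      with h | h <;> rw [h]
    · rw [ENNReal.ofReal_one]
      exact prob_le_one
    · refine (measure_mono (Sg.altViolation_subset l _)).trans ?_
      refine (measure_iUnion_le_card_mul_prod μx
        (B := tr ⁻¹' {e | ¬ tiles {e} (l + 1) ⊆ tiles (Set.range w) (l + 1)})
        (htr MeasurableSet.of_discrete)).trans ?_
      rw [← hμu, mul_comm, ENNReal.ofReal_mul' (by positivity), ENNReal.ofReal_natCast]
      gcongr
  have hcompl : Measure.pi (fun _ : Fin N => μx.prod μu) goodᶜ ≤ ENNReal.ofReal β := by
    rw [hG, ← Set.preimage_compl, ← Measure.map_apply hΓ MeasurableSet.of_discrete]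
    have hmap : (Measure.pi fun _ : Fin N => μx.prod μu).map Γ = Measure.pi fun _ => p :=
      Measure.pi_map_pi (f := fun _ : Fin N => tr) fun _ => htr.aemeasurable
    rw [hmap]
    exact (measure_mono hsub).trans hbad
  rw [ENNReal.ofReal_sub _ hβ0.le, ENNReal.ofReal_one]
  rw [prob_compl_eq_one_sub hmeas] at hcompl
  exact tsub_le_iff_tsub_le.1 hcompl
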